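/- \textbf{Theorem.} Let $V$ be a set of propositional letters, and consider formulas built from $V$ with the classical connectives, a binary connective $\rightsquigarrow$ and a unary connective $\Box$; write $[\forall]\phi$ for $\top\rightsquigarrow\phi$. Let $\mathsf{MS^2IC}$ be the propositional modal system whose axioms are all substitution instances of classical tautologies and all instances of \begin{itemize} \item[(A1)] $(\bot\rightsquigarrow\phi)\wedge(\phi\rightsquigarrow\top)$; \item[(A2)] $[(\phi\vee\psi)\rightsquigarrow\chi]\leftrightarrow[(\phi\rightsquigarrow\chi)\wedge(\psi\rightsquigarrow\chi)]$; \item[(A3)] $[\phi\rightsquigarrow(\psi\wedge\chi)]\leftrightarrow[(\phi\rightsquigarrow\psi)\wedge(\phi\rightsquigarrow\chi)]$; \item[(A4)] $(\phi\rightsquigarrow\psi)\to(\phi\to\psi)$; \item[(A5)] $(\phi\rightsquigarrow\psi)\leftrightarrow(\neg\psi\rightsquigarrow\neg\phi)$; \item[(A8)] $[\forall]\phi\to[\forall][\forall]\phi$; \item[(A9)] $\neg[\forall]\phi\to[\forall]\neg[\forall]\phi$; \item[(A10)] $(\phi\rightsquigarrow\psi)\leftrightarrow[\forall](\phi\rightsquigarrow\psi)$;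 \item[(A11)] $[\forall]\phi\to(\neg[\forall]\phi\rightsquigarrow\bot)$; \item[(K)] $\Box(\phi\to\psi)\to(\Box\phi\to\Box\psi)$; \item[(Add)] $(\phi\rightsquigarrow\psi)\to(\Box\phi\rightsquigarrow\Box\psi)$; \end{itemize} and whose rules are modus ponens, $\phi/[\forall]\phi$, $\phi/\Box\phi$, and replacement of equivalents under $\rightsquigarrow$: from $\phi\leftrightarrow\phi'$ and $\psi\leftrightarrow\psi'$ infer $(\phi\rightsquigarrow\psi)\leftrightarrow(\phi'\rightsquigarrow\psi')$. Write $\Gamma\vdash_{\mathsf{MS^2IC}}\phi$ if $\phi$ has a proof from the set of formulas $\Gamma$ using these axioms and rules; the theorems of $\mathsf{MS^2IC}$ are the $\phi$ with $\varnothing\vdash_{\mathsf{MS^2IC}}\phi$. Let $\mathsf{MS^2IC}_u$ be obtained from $\mathsf{MS^2IC}$ by adding the rules \[ (\rho6)\ \frac{(\phi\rightsquigarrow p)\wedge(p\rightsquigarrow\psi)\to\chi}{(\phi\rightsquigarrow\psi)\to\chi},\qquad (\rho7)\ \frac{(p\rightsquigarrow\phi)\wedge p\to\chi}{\phi\to\chi},\qquad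 (\mathrm{UC})\ \frac{(p\rightsquigarrow\phi)\wedge\Box p\to\psi}{\Box\phi\to\psi}, \] where in each rule $p\in V$ is a letter that does not occur in the conclusion. Write $\Gamma\vdash_{\mathsf{MS^2IC}_u}\phi$ if there are $\gamma_1,\dots,\gamma_n\in\Gamma$ ($n\ge 0$) such that $[\forall](\gamma_1\wedge\dots\wedge\gamma_n)\to\phi$ is a theorem of $\mathsf{MS^2IC}_u$. Then $\mathsf{MS^2IC}_u$ and $\mathsf{MS^2IC}$ coincide: they have the same theorems, and $\Gamma\vdash_{\mathsf{MS^2IC}_u}\phi$ iff $\Gamma\vdash_{\mathsf{MS^2IC}}\phi$ for every set of formulas $\Gamma$ and formula $\phi$. Moreover, $(\rho6)$, $(\rho7)$ and $(\mathrm{UC})$ are admissible in $\mathsf{MS^2IC}$: whenever the premise of an instance of one of these rules is a theorem of $\mathsf{MS^2IC}$, so is its conclusion. -/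

import Mathlib

namespace MS2

/-- Formulas in the propositional letters `V`, with primitive connectives `⊥`, `→`, the binary
strict implication and the unary box. The other connectives are the usual abbreviations. -/
inductive Fml (V : Type*) : Type _
  | var : V → Fml V
  | bot : Fml V
  | imp : Fml V → Fml V → Fml V
  | strict : Fml V → Fml V → Fml V
  | box : Fml V → Fml V

namespace Fml

variable {V : Type*}

def neg (φ : Fml V) : Fml V := imp φ bot
def top : Fml V := neg bot
def or (φ ψ : Fml V) : Fml V := imp (neg φ) ψ
def and (φ ψ : Fml V) : Fml V := neg (imp φ (neg ψ))
def iff (φ ψ : Fml V) : Fml V := and (imp φ ψ) (imp ψ φ)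

/-- The universal modality `[∀] φ := ⊤ ⇝ φ`. -/
def univ (φ : Fml V) : Fml V := strict top φ

/-- `φ.Occurs p`: the letter `p` occurs in `φ`. -/
def Occurs (p : V) : Fml V → Prop
  | var q => q = p
  | bot => False
  | imp φ ψ => Occurs p φ ∨ Occurs p ψ
  | strict φ ψ => Occurs p φ ∨ Occurs p ψ
  | box φ => Occurs p φ

/-- Conjunction of a finite list of formulas; the empty conjunction is `⊤`. -/
def conj : List (Fml V) → Fml V
  | [] => top
  | φ :: l => and φ (conj l)

/-- `φ` is a substitution instance of a classical propositional tautology: it is true under every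
assignment of truth values to all formulas that respects `⊥` and `→` (letters, strict implications
and boxed formulas thus receive arbitrary truth values). -/
def IsTautology (φ : Fml V) : Prop :=
  ∀ e : Fml V → Prop, ¬ e bot → (∀ α β, e (imp α β) ↔ (e α → e β)) → e φ

end Fml

infixr:50 " →ₘ " => Fml.imp
infix:45 " ↔ₘ " => Fml.iff
infixr:60 " ∨ₘ " => Fml.or
infixr:65 " ∧ₘ " => Fml.and
infix:70 " ⇝ₘ " => Fml.strict
prefix:80 "¬ₘ" => Fml.neg
prefix:80 "□ₘ" => Fml.box
prefix:80 "[∀]ₘ" => Fml.univ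
notation "⊥ₘ" => Fml.bot
notation "⊤ₘ" => Fml.top

/-- Axioms of the modal symmetric strict implication calculus. -/
inductive Axm {V : Type*} : Fml V → Prop
  | taut (φ : Fml V) : φ.IsTautology → Axm φ
  | A1 (φ : Fml V) : Axm ((⊥ₘ ⇝ₘ φ) ∧ₘ (φ ⇝ₘ ⊤ₘ))
  | A2 (φ ψ χ : Fml V) : Axm (((φ ∨ₘ ψ) ⇝ₘ χ) ↔ₘ ((φ ⇝ₘ χ) ∧ₘ (ψ ⇝ₘ χ)))
  | A3 (φ ψ χ : Fml V) : Axm ((φ ⇝ₘ (ψ ∧ₘ χ)) ↔ₘ ((φ ⇝ₘ ψ) ∧ₘ (φ ⇝ₘ χ)))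
  | A4 (φ ψ : Fml V) : Axm ((φ ⇝ₘ ψ) →ₘ (φ →ₘ ψ))
  | A5 (φ ψ : Fml V) : Axm ((φ ⇝ₘ ψ) ↔ₘ ((¬ₘ ψ) ⇝ₘ (¬ₘ φ)))
  | A8 (φ : Fml V) : Axm (([∀]ₘ φ) →ₘ ([∀]ₘ [∀]ₘ φ))
  | A9 (φ : Fml V) : Axm ((¬ₘ [∀]ₘ φ) →ₘ ([∀]ₘ ¬ₘ [∀]ₘ φ))
  | A10 (φ ψ : Fml V) : Axm ((φ ⇝ₘ ψ) ↔ₘ ([∀]ₘ (φ ⇝ₘ ψ)))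
  | A11 (φ : Fml V) : Axm (([∀]ₘ φ) →ₘ ((¬ₘ [∀]ₘ φ) ⇝ₘ ⊥ₘ))
  | K (φ ψ : Fml V) : Axm ((□ₘ (φ →ₘ ψ)) →ₘ ((□ₘ φ) →ₘ (□ₘ ψ)))
  | Add (φ ψ : Fml V) : Axm ((φ ⇝ₘ ψ) →ₘ ((□ₘ φ) ⇝ₘ (□ₘ ψ)))

/-- `MS2IC Γ φ`: there is a proof of `φ` from `Γ` in the modal symmetric strict implication
calculus. `repl` is replacement of equivalents under the strict implication, part of being a
propositional modal system (for the box, replacement follows from `K` and `N`). -/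
inductive MS2IC {V : Type*} (Γ : Set (Fml V)) : Fml V → Prop
  | hyp {φ : Fml V} : φ ∈ Γ → MS2IC Γ φ
  | ax {φ : Fml V} : Axm φ → MS2IC Γ φ
  | MP {φ ψ : Fml V} : MS2IC Γ φ → MS2IC Γ (φ →ₘ ψ) → MS2IC Γ ψ
  | R {φ : Fml V} : MS2IC Γ φ → MS2IC Γ ([∀]ₘ φ)
  | N {φ : Fml V} : MS2IC Γ φ → MS2IC Γ (□ₘ φ)
  | repl {φ φ' ψ ψ' : Fml V} : MS2IC Γ (φ ↔ₘ φ') → MS2IC Γ (ψ ↔ₘ ψ') →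
      MS2IC Γ ((φ ⇝ₘ ψ) ↔ₘ (φ' ⇝ₘ ψ'))

/-- The rule (ρ6), as the relation between its premise and its conclusion. -/
inductive Rho6 {V : Type*} : Fml V → Fml V → Prop
  | mk (φ ψ χ : Fml V) (p : V) : ¬ φ.Occurs p → ¬ ψ.Occurs p → ¬ χ.Occurs p →
      Rho6 (((φ ⇝ₘ Fml.var p) ∧ₘ (Fml.var p ⇝ₘ ψ)) →ₘ χ) ((φ ⇝ₘ ψ) →ₘ χ)

/-- The rule (ρ7), as the relation between its premise and its conclusion. -/
inductive Rho7 {V : Type*} : Fml V → Fml V → Prop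
  | mk (φ χ : Fml V) (p : V) : ¬ φ.Occurs p → ¬ χ.Occurs p →
      Rho7 (((Fml.var p ⇝ₘ φ) ∧ₘ Fml.var p) →ₘ χ) (φ →ₘ χ)

/-- The rule (UC), as the relation between its premise and its conclusion. -/
inductive UC {V : Type*} : Fml V → Fml V → Prop
  | mk (φ ψ : Fml V) (p : V) : ¬ φ.Occurs p → ¬ ψ.Occurs p →
      UC (((Fml.var p ⇝ₘ φ) ∧ₘ (□ₘ (Fml.var p))) →ₘ ψ) ((□ₘ φ) →ₘ ψ)

/-- Theorems of the calculus obtained by adding (ρ6), (ρ7) and (UC). -/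
inductive MS2ICu {V : Type*} : Fml V → Prop
  | ax {φ : Fml V} : Axm φ → MS2ICu φ
  | MP {φ ψ : Fml V} : MS2ICu φ → MS2ICu (φ →ₘ ψ) → MS2ICu ψ
  | R {φ : Fml V} : MS2ICu φ → MS2ICu ([∀]ₘ φ)
  | N {φ : Fml V} : MS2ICu φ → MS2ICu (□ₘ φ)
  | repl {φ φ' ψ ψ' : Fml V} : MS2ICu (φ ↔ₘ φ') → MS2ICu (ψ ↔ₘ ψ') →
      MS2ICu ((φ ⇝ₘ ψ) ↔ₘ (φ' ⇝ₘ ψ'))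
  | rho6 {φ ψ : Fml V} : Rho6 φ ψ → MS2ICu φ → MS2ICu ψ
  | rho7 {φ ψ : Fml V} : Rho7 φ ψ → MS2ICu φ → MS2ICu ψ
  | uc {φ ψ : Fml V} : UC φ ψ → MS2ICu φ → MS2ICu ψ

/-- Consequence from a set of formulas in the extended calculus. -/
def MS2ICuFrom {V : Type*} (Γ : Set (Fml V)) (φ : Fml V) : Prop :=
  ∃ l : List (Fml V), (∀ γ ∈ l, γ ∈ Γ) ∧ MS2ICu (([∀]ₘ (Fml.conj l)) →ₘ φ)

/-- A rule is admissible if the theorems of the calculus without (ρ6), (ρ7), (UC) are closed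
under it. -/
def Admissible {V : Type*} (rule : Fml V → Fml V → Prop) : Prop :=
  ∀ φ ψ : Fml V, rule φ ψ → MS2IC ∅ φ → MS2IC ∅ ψ

end MS2

/-! Everything reduces to the admissibility of the three rules, which is proved semantically. The
calculus is sound and complete for frames with a reflexive symmetric relation `R`, read globally by
strict implication, and a relation `Q` for the box, linked by `comm`, which validates (Add).
Completeness (`MS2IC.complete`) uses a canonical frame in which all points share the same strict
implications.

Given a model of the antecedent of a rule's conclusion, the fresh letter `p` may have no suitable
value there, so the frame is replaced by one mapping onto it by a bounded morphism. Formulas without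
`p` keep their truth values (`Frame.sat_map`), and `p` can be valued freely upstairs. For (ρ6) the
cover is `Frame.pairs`, for (ρ7) and (UC) it is `Frame.double`. The statement about premises then
follows from `MS2IC.deduction`. -/

namespace MS2

open Fml

universe u w w'

/-! ### Kripke semantics, soundness and bounded morphisms -/

section Semantics

/-- Kripke frames for the calculus: `R` interprets the strict implication and `Q` the box. -/
structure Frame (W : Type w) where
  R : W → W → Prop
  Q : W → W → Prop
  refl : ∀ x, R x x
  symm : ∀ {x y}, R x y → R y x
  comm : ∀ {x y z}, R x y → Q y z → ∃ t, Q x t ∧ R t z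

variable {V : Type u} {W : Type w} {W' : Type w'}

/-- Satisfaction. Strict implication is evaluated globally. -/
def Frame.Sat (F : Frame W) (v : W → V → Prop) : W → Fml V → Prop
  | x, .var p => v x p
  | _, .bot => False
  | x, .imp φ ψ => F.Sat v x φ → F.Sat v x ψ
  | _, .strict φ ψ => ∀ y z, F.R y z → F.Sat v y φ → F.Sat v z ψ
  | x, .box φ => ∀ y, F.Q x y → F.Sat v y φ

namespace Frame

variable (F : Frame W) (v : W → V → Prop) (x : W) (φ ψ : Fml V)

@[simp] theorem sat_var (p : V) : F.Sat v x (.var p) ↔ v x p := by simp [Sat]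

@[simp] theorem sat_bot : ¬ F.Sat v x (.bot) := by simp [Sat]

@[simp] theorem sat_imp : F.Sat v x (.imp φ ψ) ↔ (F.Sat v x φ → F.Sat v x ψ) := by simp [Sat]

@[simp] theorem sat_strict :
    F.Sat v x (.strict φ ψ) ↔ ∀ y z, F.R y z → F.Sat v y φ → F.Sat v z ψ := by simp [Sat]

@[simp] theorem sat_box : F.Sat v x (.box φ) ↔ ∀ y, F.Q x y → F.Sat v y φ := by simp [Sat]

@[simp] theorem sat_neg : F.Sat v x (.neg φ) ↔ ¬ F.Sat v x φ := by simp [neg]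

@[simp] theorem sat_top : F.Sat v x .top := by simp [top]

@[simp] theorem sat_or : F.Sat v x (.or φ ψ) ↔ (F.Sat v x φ ∨ F.Sat v x ψ) := by
  simp [Fml.or]; tauto

@[simp] theorem sat_and : F.Sat v x (.and φ ψ) ↔ (F.Sat v x φ ∧ F.Sat v x ψ) := by
  simp [Fml.and]

@[simp] theorem sat_iff : F.Sat v x (.iff φ ψ) ↔ (F.Sat v x φ ↔ F.Sat v x ψ) := by
  simp [Fml.iff]; tauto

@[simp] theorem sat_univ : F.Sat v x (.univ φ) ↔ ∀ y, F.Sat v y φ := by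
  simp only [univ, sat_strict, sat_top, true_imp_iff]
  exact ⟨fun h y => h y y (F.refl y), fun h _ z _ => h z⟩

theorem sat_conj (l : List (Fml V)) : F.Sat v x (conj l) ↔ ∀ γ ∈ l, F.Sat v x γ := by
  induction l with
  | nil => simp [conj]
  | cons a l ih => simp [conj, ih]

end Frame

/-- Each frame condition serves an axiom: reflexivity (A4), symmetry (A5), `comm` (Add). For
(A8)–(A11), strict implications have the same truth value at all points. -/
theorem Axm.sat {φ : Fml V} (h : Axm φ) (F : Frame W) (v : W → V → Prop) (x : W) :
    F.Sat v x φ := by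
  induction h with
  | taut φ h => exact h (F.Sat v x) (by simp) (by simp)
  | A1 φ => simp
  | A2 φ ψ χ => simp; grind
  | A3 φ ψ χ => simp; grind
  | A4 φ ψ => simp only [Frame.sat_imp, Frame.sat_strict]; exact fun h => h x x (F.refl x)
  | A5 φ ψ =>
    simp only [Frame.sat_iff, Frame.sat_strict, Frame.sat_neg]
    exact ⟨fun h y z r n s => n (h z y (F.symm r) s),
      fun h y z r s => by_contra fun n => h z y (F.symm r) n s⟩
  | A8 φ => simp only [Frame.sat_imp, Frame.sat_univ]; exact fun h _ => h
  | A9 φ => simp only [Frame.sat_imp, Frame.sat_neg, Frame.sat_univ]; exact fun h _ => h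
  | A10 φ ψ =>
    simp only [Frame.sat_iff, Frame.sat_strict, Frame.sat_univ]
    exact ⟨fun h _ => h, fun h => h x⟩
  | A11 φ =>
    simp only [Frame.sat_imp, Frame.sat_neg, Frame.sat_univ, Frame.sat_strict]
    exact fun h _ _ _ n => (n h).elim
  | K φ ψ => simp only [Frame.sat_imp, Frame.sat_box]; exact fun h h' y q => h y q (h' y q)
  | Add φ ψ =>
    simp only [Frame.sat_imp, Frame.sat_strict, Frame.sat_box]
    intro h y z r hy t q
    obtain ⟨s, qs, rs⟩ := F.comm r q
    exact h s t rs (hy s qs)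

theorem MS2IC.sound {φ : Fml V} (h : MS2IC ∅ φ) (F : Frame W) (v : W → V → Prop) (x : W) :
    F.Sat v x φ := by
  induction h generalizing x with
  | hyp h => exact h.elim
  | ax h => exact h.sat F v x
  | MP _ _ h h' => exact (F.sat_imp v x _ _).1 (h' x) (h x)
  | R _ h => exact (F.sat_univ v x _).2 h
  | N _ h => exact (F.sat_box v x _).2 fun y _ => h y
  | repl _ _ h h' =>
    simp only [Frame.sat_iff, Frame.sat_strict] at h h' ⊢
    simp only [h, h']

/-- A bounded morphism of frames preserves the truth of formulas in which `p` does not occur, if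
the valuations agree on the letters other than `p`. -/
theorem Frame.sat_map {F' : Frame W'} {F : Frame W} {v' : W' → V → Prop} {v : W → V → Prop}
    (f : W' → W) (p : V)
    (hR : ∀ a b, F'.R a b → F.R (f a) (f b))
    (hR' : ∀ x y, F.R x y → ∃ a b, f a = x ∧ f b = y ∧ F'.R a b)
    (hQ : ∀ a b, F'.Q a b → F.Q (f a) (f b))
    (hQ' : ∀ a y, F.Q (f a) y → ∃ b, f b = y ∧ F'.Q a b)
    (hv : ∀ a q, q ≠ p → (v' a q ↔ v (f a) q)) {φ : Fml V} (hp : ¬ φ.Occurs p) (a : W') :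
    F'.Sat v' a φ ↔ F.Sat v (f a) φ := by
  induction φ generalizing a with
  | var q => simpa using hv a q hp
  | bot => simp
  | imp φ ψ ih ih' =>
    simp only [Occurs, not_or] at hp
    simp [ih hp.1, ih' hp.2]
  | strict φ ψ ih ih' =>
    simp only [Occurs, not_or] at hp
    simp only [sat_strict, ih hp.1, ih' hp.2]
    -- Strict implication is global, so it suffices that every `R`-edge lifts somewhere; no lift
    -- from a prescribed point is needed.
    constructor
    · intro h y z r
      obtain ⟨b, c, rfl, rfl, r'⟩ := hR' y z r
      exact h b c r'
    · exact fun h b c r => h _ _ (hR b c r)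
  | box φ ih =>
    simp only [sat_box, ih hp]
    constructor
    · intro h y q
      obtain ⟨b, rfl, q'⟩ := hQ' a y q
      exact h b q'
    · exact fun h b q => h _ (hQ a b q)

/-- The frame of `R`-related pairs, in which a pair is related to itself and to its swap. -/
def Frame.pairs (F : Frame W) : Frame {a : W × W // F.R a.1 a.2} where
  R a b := a = b ∨ a.1 = b.1.swap
  Q a b := F.Q a.1.1 b.1.1 ∧ F.Q a.1.2 b.1.2
  refl _ := .inl rfl
  symm := by
    rintro a b (h | h)
    · exact .inl h.symm
    · exact .inr (by simp [h])
  comm := by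
    rintro a b c (h | h) q
    · exact ⟨c, h ▸ q, .inl rfl⟩
    · exact ⟨⟨c.1.swap, F.symm c.2⟩, by simpa [h] using q.symm, .inr rfl⟩

/-- Two copies of a frame, with the relation for strict implication trivialized on the second. -/
def Frame.double (F : Frame W) : Frame (W × Bool) where
  R a b := a = b ∨ (a.2 = false ∧ b.2 = false ∧ F.R a.1 b.1)
  Q a b := a.2 = b.2 ∧ F.Q a.1 b.1
  refl _ := .inl rfl
  symm := by
    rintro a b (h | ⟨h, h', r⟩)
    · exact .inl h.symm
    · exact .inr ⟨h', h, F.symm r⟩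
  comm := by
    rintro a b c (rfl | ⟨h, h', r⟩) ⟨e, q⟩
    · exact ⟨c, ⟨e, q⟩, .inl rfl⟩
    · obtain ⟨t, qt, rt⟩ := F.comm r q
      exact ⟨(t, false), ⟨h, qt⟩, .inr ⟨rfl, e ▸ h', rt⟩⟩

/-- The first projection is a bounded morphism: an edge from `x` to `y` lifts to the swap edge from
`(x, y)` to `(y, x)`, and `comm` supplies the second coordinate when a `Q`-step is lifted. -/
theorem Frame.sat_pairs (F : Frame W) (v : W → V → Prop) (p : V)
    (s : {a : W × W // F.R a.1 a.2} → Prop) {φ : Fml V} (hp : ¬ φ.Occurs p)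
    (a : {a : W × W // F.R a.1 a.2}) :
    F.pairs.Sat (fun a q => (q = p ∧ s a) ∨ (q ≠ p ∧ v a.1.1 q)) a φ ↔ F.Sat v a.1.1 φ := by
  refine Frame.sat_map (F' := F.pairs) (F := F) (fun a => a.1.1) p ?_ ?_ (fun _ _ => And.left) ?_ ?_ hp a
  · rintro a b (rfl | h)
    · exact F.refl _
    · have := F.symm b.2
      simpa [h] using this
  · exact fun x y r => ⟨⟨(x, y), r⟩, ⟨(y, x), F.symm r⟩, rfl, rfl, .inr rfl⟩
  · intro a y q
    obtain ⟨t, qt, rt⟩ := F.comm (F.symm a.2) q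
    exact ⟨⟨(y, t), F.symm rt⟩, rfl, q, qt⟩
  · intro a q hq
    simp [hq]

/-- The projection is a bounded morphism: `R`-edges lift to the first copy, and `Q`-steps lift
within either copy. -/
theorem Frame.sat_double (F : Frame W) (v : W → V → Prop) (p : V)
    (s : W × Bool → Prop) {φ : Fml V} (hp : ¬ φ.Occurs p) (a : W × Bool) :
    F.double.Sat (fun a q => (q = p ∧ s a) ∨ (q ≠ p ∧ v a.1 q)) a φ ↔ F.Sat v a.1 φ := by
  refine Frame.sat_map (F' := F.double) (F := F) (fun a => a.1) p ?_ ?_ (fun _ _ => And.right) ?_ ?_ hp a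
  · rintro a b (rfl | ⟨-, -, h⟩)
    · exact F.refl _
    · exact h
  · exact fun x y r => ⟨(x, false), (y, false), rfl, rfl, .inr ⟨rfl, rfl, r⟩⟩
  · exact fun a y q => ⟨(y, a.2), rfl, rfl, q⟩
  · intro a q hq
    simp [hq]

end Semantics

/-! ### Maximal theories and the canonical frame -/

section Completeness

variable {V : Type u}

/-- Sets of formulas closed under classical propositional consequence. -/
structure IsTheory (T : Set (Fml V)) : Prop where
  taut : ∀ {φ : Fml V}, φ.IsTautology → φ ∈ T
  mp : ∀ {φ ψ : Fml V}, φ ∈ T → (φ →ₘ ψ) ∈ T → ψ ∈ T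

/-- Maximal consistent theories. -/
structure IsMaximal (x : Set (Fml V)) : Prop extends IsTheory x where
  bot : ⊥ₘ ∉ x
  total : ∀ φ : Fml V, φ ∈ x ∨ (φ →ₘ ⊥ₘ) ∈ x

theorem IsTheory.exists_isMaximal {T : Set (Fml V)} (hT : IsTheory T) {φ : Fml V} (hφ : φ ∉ T) :
    ∃ x, T ⊆ x ∧ IsMaximal x ∧ φ ∉ x := by
  obtain ⟨x, hTx, hx⟩ := zorn_subset_nonempty {S : Set (Fml V) | IsTheory S ∧ φ ∉ S} (by
    intro c hc hch ⟨S₀, hS₀⟩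
    refine ⟨⋃₀ c, ⟨⟨fun h => ⟨S₀, hS₀, (hc hS₀).1.taut h⟩, ?_⟩, ?_⟩,
      fun S hS => Set.subset_sUnion_of_mem hS⟩
    · rintro α β ⟨S, hS, hα⟩ ⟨S', hS', hαβ⟩
      rcases hch.total hS hS' with h | h
      · exact ⟨S', hS', (hc hS').1.mp (h hα) hαβ⟩
      · exact ⟨S, hS, (hc hS).1.mp hα (h hαβ)⟩
    · rintro ⟨S, hS, h⟩
      exact (hc hS).2 h) T ⟨hT, hφ⟩
  obtain ⟨⟨hth, hφx⟩, hmax⟩ := hx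
  -- Otherwise the theory generated by `x` and `α` would still avoid `φ`, against the maximality of
  -- `x`.
  have key : ∀ α, α ∉ x → (α →ₘ φ) ∈ x := by
    intro α hα
    by_contra h
    have hth' : IsTheory {β | (α →ₘ β) ∈ x} := by
      refine ⟨fun {β} hβ => hth.taut fun e h0 h1 => ?_, fun {β γ} hβ hγ => ?_⟩
      · rw [h1]; exact fun _ => hβ e h0 h1
      · refine hth.mp hγ (hth.mp hβ (hth.taut fun e h0 h1 => ?_))
        simp only [h1]; tauto
    refine hα (hmax ⟨hth', h⟩ (fun β hβ => hth.mp hβ (hth.taut fun e h0 h1 => ?_))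
      (hth.taut fun e h0 h1 => ?_))
    · simp only [h1]; tauto
    · simp only [h1]; tauto
  refine ⟨x, hTx, ⟨hth, fun h => hφx (hth.mp h (hth.taut fun e h0 h1 => ?_)), fun α => ?_⟩, hφx⟩
  · simp only [h1]; tauto
  · by_contra! h
    refine hφx (hth.mp (key _ h.2) (hth.mp (key _ h.1) (hth.taut fun e h0 h1 => ?_)))
    simp only [h1]; tauto

namespace IsMaximal

variable {x : Set (Fml V)}

theorem mem_imp (hx : IsMaximal x) {φ ψ : Fml V} : (φ →ₘ ψ) ∈ x ↔ (φ ∈ x → ψ ∈ x) := by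
  refine ⟨fun h h' => hx.mp h' h, fun h => ?_⟩
  rcases hx.total φ with h' | h'
  · exact hx.mp (h h') (hx.taut fun e h0 h1 => by simp only [h1]; tauto)
  · exact hx.mp h' (hx.taut fun e h0 h1 => by simp only [h1]; tauto)

theorem mem_neg (hx : IsMaximal x) {φ : Fml V} : (¬ₘ φ) ∈ x ↔ φ ∉ x := by
  simp [neg, hx.mem_imp, hx.bot]

theorem mem_top (hx : IsMaximal x) : ⊤ₘ ∈ x := by simp [top, hx.mem_neg, hx.bot]

theorem mem_and (hx : IsMaximal x) {φ ψ : Fml V} : (φ ∧ₘ ψ) ∈ x ↔ φ ∈ x ∧ ψ ∈ x := by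
  simp [Fml.and, hx.mem_imp, hx.mem_neg]

theorem mem_iff (hx : IsMaximal x) {φ ψ : Fml V} : (φ ↔ₘ ψ) ∈ x ↔ (φ ∈ x ↔ ψ ∈ x) := by
  simp [Fml.iff, hx.mem_imp, hx.mem_and]; tauto

end IsMaximal

theorem MS2IC.of_isTautology {Γ : Set (Fml V)} {φ : Fml V}
    (h : ∀ e : Fml V → Prop, ¬ e .bot → (∀ α β, e (.imp α β) ↔ (e α → e β)) → e φ) :
    MS2IC Γ φ :=
  .ax (.taut φ h)

theorem MS2IC.isTheory (Γ : Set (Fml V)) : IsTheory {φ | MS2IC Γ φ} :=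
  ⟨fun h => .ax (.taut _ h), fun h h' => .MP h h'⟩

/-- The theories of the points of a connected frame: the formulas of shape `φ ⇝ ψ` are decided, and
the theory is closed under the rules of the calculus. -/
structure IsSimple (T : Set (Fml V)) : Prop extends IsTheory T where
  ax : ∀ {φ : Fml V}, Axm φ → φ ∈ T
  nec : ∀ {φ : Fml V}, φ ∈ T → (□ₘ φ) ∈ T
  univ : ∀ {φ : Fml V}, φ ∈ T → ([∀]ₘ φ) ∈ T
  decides : ∀ φ ψ : Fml V, (φ ⇝ₘ ψ) ∈ T ∨ (¬ₘ (φ ⇝ₘ ψ)) ∈ T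
  mono : ∀ {φ ψ χ : Fml V}, (φ ⇝ₘ ψ) ∈ T → (ψ →ₘ χ) ∈ T → (φ ⇝ₘ χ) ∈ T

namespace IsMaximal

variable {x : Set (Fml V)}

/-- If `φ → ψ` is a theorem, `ψ` may be replaced by `φ ∨ ψ`, which (A2) splits. `strict_right` is
the dual, with (A3). -/
theorem strict_left (hx : IsMaximal x) (hth : ∀ {φ}, MS2IC ∅ φ → φ ∈ x) {φ ψ χ : Fml V}
    (h : MS2IC ∅ (φ →ₘ ψ)) (h' : (ψ ⇝ₘ χ) ∈ x) : (φ ⇝ₘ χ) ∈ x := by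
  have h1 : MS2IC ∅ (ψ ↔ₘ (φ ∨ₘ ψ)) := .MP h <| .of_isTautology fun e h0 h1 => by
    simp only [Fml.iff, Fml.and, Fml.or, neg, h1]; tauto
  have h2 : MS2IC ∅ (χ ↔ₘ χ) := .of_isTautology fun e h0 h1 => by
    simp only [Fml.iff, Fml.and, neg, h1]; tauto
  have h3 := hx.mem_iff.1 (hth (.repl h1 h2))
  have h4 := hx.mem_iff.1 (hth (.ax (.A2 φ ψ χ)))
  exact (hx.mem_and.1 (h4.1 (h3.1 h'))).1

theorem strict_right (hx : IsMaximal x) (hth : ∀ {φ}, MS2IC ∅ φ → φ ∈ x) {φ ψ χ : Fml V}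
    (h : MS2IC ∅ (ψ →ₘ χ)) (h' : (φ ⇝ₘ ψ) ∈ x) : (φ ⇝ₘ χ) ∈ x := by
  have h1 : MS2IC ∅ (ψ ↔ₘ (ψ ∧ₘ χ)) := .MP h <| .of_isTautology fun e h0 h1 => by
    simp only [Fml.iff, Fml.and, neg, h1]; tauto
  have h2 : MS2IC ∅ (φ ↔ₘ φ) := .of_isTautology fun e h0 h1 => by
    simp only [Fml.iff, Fml.and, neg, h1]; tauto
  have h3 := hx.mem_iff.1 (hth (.repl h2 h1))
  have h4 := hx.mem_iff.1 (hth (.ax (.A3 φ ψ χ)))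
  exact (hx.mem_and.1 (h4.1 (h3.1 h'))).2

theorem isSimple (hx : IsMaximal x) (hth : ∀ {φ}, MS2IC ∅ φ → φ ∈ x) :
    IsSimple {φ | ([∀]ₘ φ) ∈ x} := by
  have mono : ∀ {φ ψ χ : Fml V}, (φ ⇝ₘ ψ) ∈ x → ([∀]ₘ (ψ →ₘ χ)) ∈ x → (φ ⇝ₘ χ) ∈ x := by
    intro φ ψ χ h h'
    have h1 : (φ ⇝ₘ (ψ →ₘ χ)) ∈ x := hx.strict_left hth (.of_isTautology fun e h0 h1 => by
      simp only [top, neg, h1]; tauto) h'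
    have h2 := (hx.mem_iff.1 (hth (.ax (.A3 φ ψ (ψ →ₘ χ))))).2 (hx.mem_and.2 ⟨h, h1⟩)
    exact hx.strict_right hth (.of_isTautology fun e h0 h1 => by
      simp only [Fml.and, neg, h1]; tauto) h2
  refine ⟨⟨fun h => hth (.R (.of_isTautology h)), fun h h' => mono h h'⟩,
    fun h => hth (.R (.ax h)), ?_, fun h => hx.mp h (hth (.ax (.A8 _))), ?_, ?_⟩
  -- (Add) turns `⊤ ⇝ φ` into `□⊤ ⇝ □φ`, and `□⊤` is a theorem.
  · intro φ h
    have h1 : MS2IC ∅ ((□ₘ ⊤ₘ : Fml V)) := .N (.of_isTautology fun e h0 h1 => by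
      simp only [top, neg, h1]; tauto)
    have h2 : MS2IC ∅ (⊤ₘ →ₘ (□ₘ ⊤ₘ : Fml V)) := .MP h1 (.of_isTautology fun e h0 h1 => by
      simp only [h1]; tauto)
    exact hx.strict_left hth h2 (hx.mp h (hth (.ax (.Add _ _))))
  · intro φ ψ
    by_cases h : (φ ⇝ₘ ψ) ∈ x
    · exact .inl ((hx.mem_iff.1 (hth (.ax (.A10 φ ψ)))).1 h)
    -- (A10) passes failure of `φ ⇝ ψ` to its universal closure, and (A9) makes that failure
    -- universal.
    · right
      have h1 : ([∀]ₘ (φ ⇝ₘ ψ)) ∉ x := fun h' => h ((hx.mem_iff.1 (hth (.ax (.A10 φ ψ)))).2 h')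
      have h2 := hx.mp (hx.mem_neg.2 h1) (hth (.ax (.A9 _)))
      refine mono h2 (hth (.R (.MP (.ax (.A10 φ ψ)) (.of_isTautology fun e h0 h1 => ?_))))
      simp only [Fml.iff, Fml.and, neg, h1]; tauto
  · intro φ ψ χ h h'
    exact (hx.mem_iff.1 (hth (.ax (.A10 φ χ)))).1
      (mono ((hx.mem_iff.1 (hth (.ax (.A10 φ ψ)))).2 h) h')

end IsMaximal

namespace IsSimple

variable {T : Set (Fml V)}

theorem of_taut (hT : IsSimple T) {φ ψ : Fml V} (h : φ ∈ T)
    (h' : ∀ e : Fml V → Prop, ¬ e .bot → (∀ α β, e (.imp α β) ↔ (e α → e β)) → e φ → e ψ) :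
    ψ ∈ T :=
  hT.mp h (hT.taut fun e h0 h1 => (h1 _ _).2 (h' e h0 h1))

theorem iff_mem (hT : IsSimple T) {φ ψ : Fml V} (h : (φ ↔ₘ ψ) ∈ T) : φ ∈ T ↔ ψ ∈ T := by
  constructor <;> refine fun h' => hT.mp h' (hT.of_taut h fun e h0 h1 => ?_) <;>
    simp only [Fml.iff, Fml.and, neg, h1] <;> tauto

theorem and_mem (hT : IsSimple T) {φ ψ : Fml V} (h : φ ∈ T) (h' : ψ ∈ T) : (φ ∧ₘ ψ) ∈ T :=
  hT.mp h' (hT.of_taut h fun e h0 h1 => by simp only [Fml.and, neg, h1]; tauto)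

theorem contrapose (hT : IsSimple T) {φ ψ : Fml V} : (φ ⇝ₘ ψ) ∈ T ↔ ((¬ₘ ψ) ⇝ₘ (¬ₘ φ)) ∈ T :=
  hT.iff_mem (hT.ax (.A5 φ ψ))

theorem mono_left (hT : IsSimple T) {φ ψ χ : Fml V} (h : (φ →ₘ ψ) ∈ T) (h' : (ψ ⇝ₘ χ) ∈ T) :
    (φ ⇝ₘ χ) ∈ T :=
  hT.contrapose.2 (hT.mono (hT.contrapose.1 h') (hT.of_taut h fun e h0 h1 => by
    simp only [neg, h1]; tauto))

theorem strict_and (hT : IsSimple T) {φ ψ χ : Fml V} (h : (φ ⇝ₘ ψ) ∈ T) (h' : (φ ⇝ₘ χ) ∈ T) :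
    (φ ⇝ₘ (ψ ∧ₘ χ)) ∈ T :=
  (hT.iff_mem (hT.ax (.A3 φ ψ χ))).2 (hT.and_mem h h')

theorem strict_of_mem (hT : IsSimple T) {φ ψ : Fml V} (h : ψ ∈ T) : (φ ⇝ₘ ψ) ∈ T :=
  hT.mono_left (hT.taut fun e h0 h1 => by simp only [top, neg, h1]; tauto) (hT.univ h)

theorem isTheory_strict (hT : IsSimple T) (φ : Fml V) : IsTheory {ψ | (φ ⇝ₘ ψ) ∈ T} where
  taut h := hT.strict_of_mem (hT.taut h)
  mp h h' := hT.mono (hT.strict_and h h') (hT.taut fun e h0 h1 => by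
    simp only [Fml.and, neg, h1]; tauto)

/-- The theory shared by the successors of `x` under the relation for strict implication. -/
theorem isTheory_image (hT : IsSimple T) {x : Set (Fml V)} (hx : IsMaximal x) :
    IsTheory {ψ | ∃ φ ∈ x, (φ ⇝ₘ ψ) ∈ T} where
  taut h := ⟨⊤ₘ, hx.mem_top, hT.strict_of_mem (hT.taut h)⟩
  mp := by
    rintro α β ⟨φ, hφ, h⟩ ⟨ψ, hψ, h'⟩
    have h1 : ((φ ∧ₘ ψ) →ₘ φ) ∈ T := hT.taut fun e h0 h1 => by
      simp only [Fml.and, neg, h1]; tauto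
    have h2 : ((φ ∧ₘ ψ) →ₘ ψ) ∈ T := hT.taut fun e h0 h1 => by
      simp only [Fml.and, neg, h1]; tauto
    exact ⟨φ ∧ₘ ψ, hx.mem_and.2 ⟨hφ, hψ⟩,
      (hT.isTheory_strict _).mp (hT.mono_left h1 h) (hT.mono_left h2 h')⟩

theorem box_mp (hT : IsSimple T) {x : Set (Fml V)} (hx : IsMaximal x) (hTx : T ⊆ x)
    {φ ψ : Fml V} (h : (□ₘ φ) ∈ x) (h' : (□ₘ (φ →ₘ ψ)) ∈ x) : (□ₘ ψ) ∈ x :=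
  hx.mp h (hx.mp h' (hTx (hT.ax (.K φ ψ))))

theorem box_mono (hT : IsSimple T) {x : Set (Fml V)} (hx : IsMaximal x) (hTx : T ⊆ x)
    {φ ψ : Fml V} (h : (□ₘ φ) ∈ x) (h' : (φ →ₘ ψ) ∈ T) : (□ₘ ψ) ∈ x :=
  hT.box_mp hx hTx h (hTx (hT.nec h'))

/-- The canonical frame over a simple theory. -/
def frame (hT : IsSimple T) : Frame {x : Set (Fml V) // IsMaximal x ∧ T ⊆ x} where
  R x y := ∀ φ ψ : Fml V, (φ ⇝ₘ ψ) ∈ T → φ ∈ x.1 → ψ ∈ y.1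
  Q x y := ∀ φ : Fml V, (□ₘ φ) ∈ x.1 → φ ∈ y.1
  refl x φ ψ h hφ := x.2.1.mp hφ (x.2.2 (hT.mp h (hT.ax (.A4 φ ψ))))
  symm := by
    intro x y r φ ψ h hφ
    by_contra hψ
    exact y.2.1.mem_neg.1 (r _ _ (hT.contrapose.1 h) (x.2.1.mem_neg.2 hψ)) hφ
  comm := by
    rintro ⟨x, hx, hTx⟩ ⟨y, hy, hTy⟩ ⟨z, hz, hTz⟩ r q
    have hS := hT.isTheory_image hz
    -- The required `t` must contain all `φ` with `□φ ∈ x` and everything forced by `z` along `R`;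
    -- this is the theory generated by both.
    have hU : IsTheory {χ : Fml V | ∃ δ ∈ {ψ | ∃ φ ∈ z, (φ ⇝ₘ ψ) ∈ T}, (□ₘ (δ →ₘ χ)) ∈ x} := by
      refine ⟨fun {χ} h => ⟨χ, hS.taut h, hTx (hT.nec (hT.taut fun e h0 h1 => ?_))⟩, ?_⟩
      · simp only [h1]; tauto
      · rintro α β ⟨δ, hδ, h⟩ ⟨ε, hε, h'⟩
        refine ⟨δ ∧ₘ ε, hS.mp hε (hS.mp hδ (hS.taut fun e h0 h1 => ?_)),
          hT.box_mp hx hTx h (hT.box_mono hx hTx h' (hT.taut fun e h0 h1 => ?_))⟩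
        · simp only [Fml.and, neg, h1]; tauto
        · simp only [Fml.and, neg, h1]; tauto
    obtain ⟨t, hUt, ht, -⟩ := hU.exists_isMaximal (φ := .bot) (by
      -- Consistency: if `φ ⇝ δ` with `φ ∈ z` and `□¬δ ∈ x`, then (A5) and (Add) give `□¬δ ⇝ □¬φ`,
      -- so `□¬φ ∈ y` and `¬φ ∈ z`.
      rintro ⟨δ, ⟨φ, hφ, h⟩, hb⟩
      have h1 := hT.mp (hT.contrapose.1 h) (hT.ax (.Add _ _))
      exact hz.mem_neg.1 (q _ (r _ _ h1 hb)) hφ)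
    have hbox : ∀ φ : Fml V, (□ₘ φ) ∈ x → φ ∈ t := fun φ h =>
      hUt ⟨⊤ₘ, ⟨⊤ₘ, hz.mem_top, hT.strict_of_mem (hT.taut fun e h0 h1 => by
        simp only [top, neg, h1]; tauto)⟩, hT.box_mono hx hTx h (hT.taut fun e h0 h1 => by
        simp only [top, neg, h1]; tauto)⟩
    refine ⟨⟨t, ht, fun φ h => hbox φ (hTx (hT.nec h))⟩, hbox, fun φ ψ h hφ => ?_⟩
    by_contra hψ
    refine ht.mem_neg.1 (hUt ⟨¬ₘ φ, ⟨¬ₘ ψ, hz.mem_neg.2 hψ, hT.contrapose.1 h⟩,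
      hTx (hT.nec (hT.taut fun e h0 h1 => ?_))⟩) hφ
    simp only [neg, h1]; tauto

theorem sat_frame (hT : IsSimple T) (φ : Fml V) (x : {x : Set (Fml V) // IsMaximal x ∧ T ⊆ x}) :
    hT.frame.Sat (fun x p => .var p ∈ x.1) x φ ↔ φ ∈ x.1 := by
  induction φ generalizing x with
  | var p => simp
  | bot => simpa using x.2.1.bot
  | imp φ ψ ih ih' => simp [ih, ih', x.2.1.mem_imp]
  | strict φ ψ ih ih' =>
    simp only [Frame.sat_strict, ih, ih']
    constructor
    · intro h
      rcases hT.decides φ ψ with h' | h'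
      · exact x.2.2 h'
      by_cases hn : (φ ⇝ₘ ψ) ∈ T
      · exact x.2.2 hn
      -- A strict implication outside `T` is refuted by an edge: `z` omits `ψ` and contains all that
      -- `φ` strictly implies, which leaves room for an `R`-neighbour `y` of `z` containing `φ`.
      obtain ⟨z, hSz, hz, hψ⟩ := (hT.isTheory_strict φ).exists_isMaximal hn
      obtain ⟨y, hSy, hy, hφ⟩ := (hT.isTheory_image hz).exists_isMaximal (φ := ¬ₘ φ) (by
        rintro ⟨δ, hδ, hd⟩
        refine hz.mem_neg.1 (hSz (hT.mono_left ?_ (hT.contrapose.1 hd))) hδ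
        exact hT.taut fun e h0 h1 => by simp only [neg, h1]; tauto)
      have hTz : T ⊆ z := fun χ hχ => hSz (hT.strict_of_mem hχ)
      have hTy : T ⊆ y := fun χ hχ => hSy ⟨⊤ₘ, hz.mem_top, hT.strict_of_mem hχ⟩
      have r : hT.frame.R ⟨z, hz, hTz⟩ ⟨y, hy, hTy⟩ := fun α β hαβ hα => hSy ⟨α, hα, hαβ⟩
      exact (hψ (h _ _ (hT.frame.symm r) (by simpa [hy.mem_neg] using hφ))).elim
    · intro h
      rcases hT.decides φ ψ with h' | h'
      · exact fun y z r => r φ ψ h'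
      · exact (x.2.1.mem_neg.1 (x.2.2 h') h).elim
  | box φ ih =>
    simp only [Frame.sat_box, ih]
    constructor
    · intro h
      by_contra hn
      have hS : IsTheory {χ : Fml V | (□ₘ χ) ∈ x.1} :=
        ⟨fun h => x.2.2 (hT.nec (hT.taut h)), fun h h' => hT.box_mp x.2.1 x.2.2 h h'⟩
      obtain ⟨y, hSy, hy, hφ⟩ := hS.exists_isMaximal hn
      exact hφ (h ⟨y, hy, fun χ hχ => hSy (x.2.2 (hT.nec hχ))⟩ fun χ hχ => hSy hχ)
    · exact fun h y q => q φ h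

end IsSimple

/-- Completeness of the calculus for Kripke frames. -/
theorem MS2IC.complete {φ : Fml V}
    (h : ∀ (W : Type u) (F : Frame W) (v : W → V → Prop) (x : W), F.Sat v x φ) : MS2IC ∅ φ := by
  by_contra hn
  obtain ⟨x, hTx, hx, hφ⟩ := (MS2IC.isTheory ∅).exists_isMaximal hn
  have hT := hx.isSimple fun h => hTx h
  refine hφ ((hT.sat_frame φ ⟨x, hx, fun χ hχ => ?_⟩).1 (h _ _ _ _))
  -- `x` is itself a point of its canonical frame: (A4) gives `χ` from `⊤ ⇝ χ`.
  exact hx.mp hx.mem_top (hx.mp hχ (hTx (.ax (.A4 _ _))))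

end Completeness

/-! ### Admissibility of the rules and the global deduction theorem -/

section Rules

variable {V : Type u}

theorem admissible_rho6 : Admissible (Rho6 (V := V)) := by
  rintro _ _ ⟨φ, ψ, χ, p, hφ, hψ, hχ⟩ h
  refine .complete fun W F v x => ?_
  simp only [Frame.sat_imp, Frame.sat_strict]
  intro hs
  -- Let `p` hold where either coordinate satisfies `φ`. This is invariant under swapping, whence `φ
  -- ⇝ p`; the coordinates are `R`-related, so `φ ⇝ ψ` gives `ψ` at both of them, whence `p ⇝ ψ`.
  have key := fun {θ : Fml V} (hθ : ¬ θ.Occurs p) => F.sat_pairs v p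
    (fun a => F.Sat v a.1.1 φ ∨ F.Sat v a.1.2 φ) hθ
  have := h.sound F.pairs (fun a q => (q = p ∧ (F.Sat v a.1.1 φ ∨ F.Sat v a.1.2 φ)) ∨
    (q ≠ p ∧ v a.1.1 q)) ⟨(x, x), F.refl x⟩
  simp only [Frame.sat_imp, Frame.sat_and, Frame.sat_strict, key hφ, key hψ, key hχ,
    Frame.sat_var, true_and, ne_eq, not_true_eq_false, false_and, or_false] at this
  refine this ⟨?_, ?_⟩
  · rintro a b (rfl | r) ha
    · exact .inl ha
    · exact .inr (by simpa [r] using ha)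
  · rintro a b (rfl | r) (ha | ha)
    · exact hs _ _ (F.refl _) ha
    · exact hs _ _ (F.symm a.2) ha
    · exact hs _ _ (F.symm b.2) (by simpa [r] using ha)
    · exact hs _ _ (F.refl _) (by simpa [r] using ha)

theorem admissible_rho7 : Admissible (Rho7 (V := V)) := by
  rintro _ _ ⟨φ, χ, p, hφ, hχ⟩ h
  refine .complete fun W F v x => ?_
  simp only [Frame.sat_imp]
  intro hs
  -- Let `p` be `φ` restricted to the second copy. Points there are `R`-related only to themselves,
  -- so `p ⇝ φ` holds, and `(x, true)` satisfies `p`.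
  have key := fun {θ : Fml V} (hθ : ¬ θ.Occurs p) => F.sat_double v p
    (fun a => a.2 = true ∧ F.Sat v a.1 φ) hθ
  have := h.sound F.double (fun a q => (q = p ∧ (a.2 = true ∧ F.Sat v a.1 φ)) ∨
    (q ≠ p ∧ v a.1 q)) (x, true)
  simp only [Frame.sat_imp, Frame.sat_and, Frame.sat_strict, key hφ, key hχ,
    Frame.sat_var, true_and, ne_eq, not_true_eq_false, false_and, or_false] at this
  refine this ⟨?_, hs⟩
  rintro a b (rfl | ⟨r, -⟩) ⟨ha, ha'⟩
  · exact ha'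
  · simp [r] at ha

theorem admissible_uc : Admissible (UC (V := V)) := by
  rintro _ _ ⟨φ, ψ, p, hφ, hψ⟩ h
  refine .complete fun W F v x => ?_
  simp only [Frame.sat_imp, Frame.sat_box]
  intro hs
  have key := fun {θ : Fml V} (hθ : ¬ θ.Occurs p) => F.sat_double v p
    (fun a => a.2 = true ∧ F.Sat v a.1 φ) hθ
  have := h.sound F.double (fun a q => (q = p ∧ (a.2 = true ∧ F.Sat v a.1 φ)) ∨
    (q ≠ p ∧ v a.1 q)) (x, true)
  simp only [Frame.sat_imp, Frame.sat_and, Frame.sat_strict, Frame.sat_box, key hφ, key hψ,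
    Frame.sat_var, true_and, ne_eq, not_true_eq_false, false_and, or_false] at this
  -- `Q` preserves the copy, so all successors of `(x, true)` lie where `p` agrees with `φ`, and
  -- `□p` follows from `□φ`.
  refine this ⟨?_, fun b q => ⟨q.1.symm, hs _ q.2⟩⟩
  rintro a b (rfl | ⟨r, -⟩) ⟨ha, ha'⟩
  · exact ha'
  · simp [r] at ha

theorem MS2ICu_iff (φ : Fml V) : MS2ICu φ ↔ MS2IC ∅ φ := by
  constructor <;> intro h
  · induction h with
    | ax h => exact .ax h
    | MP _ _ h h' => exact .MP h h'
    | R _ h => exact .R h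
    | N _ h => exact .N h
    | repl _ _ h h' => exact .repl h h'
    | rho6 r _ h => exact admissible_rho6 _ _ r h
    | rho7 r _ h => exact admissible_rho7 _ _ r h
    | uc r _ h => exact admissible_uc _ _ r h
  · induction h with
    | hyp h => exact h.elim
    | ax h => exact .ax h
    | MP _ _ h h' => exact .MP h h'
    | R _ h => exact .R h
    | N _ h => exact .N h
    | repl _ _ h h' => exact .repl h h'

theorem MS2IC.mono {Γ Δ : Set (Fml V)} (hΓ : Γ ⊆ Δ) {φ : Fml V} (h : MS2IC Γ φ) :
    MS2IC Δ φ := by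
  induction h with
  | hyp h => exact .hyp (hΓ h)
  | ax h => exact .ax h
  | MP _ _ h h' => exact .MP h h'
  | R _ h => exact .R h
  | N _ h => exact .N h
  | repl _ _ h h' => exact .repl h h'

theorem MS2IC.conj {Γ : Set (Fml V)} {l : List (Fml V)} (hl : ∀ γ ∈ l, γ ∈ Γ) :
    MS2IC Γ (Fml.conj l) := by
  induction l with
  | nil => exact .of_isTautology fun e h0 h1 => by simp only [Fml.conj, top, neg, h1]; tauto
  | cons γ l ih =>
    have h := ih fun δ hδ => hl δ (List.mem_cons_of_mem _ hδ)
    exact .MP h (.MP (.hyp (hl γ List.mem_cons_self)) (.of_isTautology fun e h0 h1 => by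
      simp only [Fml.conj, Fml.and, neg, h1]; tauto))

/-- The global deduction theorem. -/
theorem MS2IC.deduction {Γ : Set (Fml V)} {φ : Fml V} (h : MS2IC Γ φ) :
    ∃ l : List (Fml V), (∀ γ ∈ l, γ ∈ Γ) ∧ MS2IC ∅ (([∀]ₘ (Fml.conj l)) →ₘ φ) := by
  -- By soundness and completeness, theoremhood of `[∀](conj l) → ψ` means that `ψ` holds throughout
  -- every model in which `l` does. Each rule preserves this global consequence.
  have valid {l : List (Fml V)} {ψ : Fml V} (h : MS2IC ∅ (([∀]ₘ (Fml.conj l)) →ₘ ψ))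
      (W : Type u) (F : Frame W) (v : W → V → Prop)
      (hl : ∀ y, ∀ γ ∈ l, F.Sat v y γ) (x : W) : F.Sat v x ψ := by
    have := h.sound F v x
    simp only [Frame.sat_imp, Frame.sat_univ, Frame.sat_conj] at this
    exact this hl
  have intro {l : List (Fml V)} {ψ : Fml V} (h : ∀ (W : Type u) (F : Frame W)
      (v : W → V → Prop), (∀ y, ∀ γ ∈ l, F.Sat v y γ) → ∀ x, F.Sat v x ψ) :
      MS2IC ∅ (([∀]ₘ (Fml.conj l)) →ₘ ψ) := by
    refine .complete fun W F v x => ?_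
    simp only [Frame.sat_imp, Frame.sat_univ, Frame.sat_conj]
    exact fun hl => h W F v hl x
  induction h with
  | @hyp φ h =>
    exact ⟨[φ], by simpa using h, intro fun W F v hl x => hl x φ (by simp)⟩
  | ax h => exact ⟨[], by simp, intro fun W F v _ x => h.sat F v x⟩
  | MP _ _ h h' =>
    obtain ⟨l, hl, h⟩ := h
    obtain ⟨l', hl', h'⟩ := h'
    refine ⟨l ++ l', by simpa [or_imp, forall_and] using ⟨hl, hl'⟩, intro fun W F v hs x => ?_⟩
    have h' := valid h' W F v (fun y γ hγ => hs y γ (List.mem_append_right _ hγ)) x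
    exact (F.sat_imp v x _ _).1 h'
      (valid h W F v (fun y γ hγ => hs y γ (List.mem_append_left _ hγ)) x)
  | R _ h =>
    obtain ⟨l, hl, h⟩ := h
    refine ⟨l, hl, intro fun W F v hs x => ?_⟩
    exact (F.sat_univ v x _).2 (valid h W F v hs)
  | N _ h =>
    obtain ⟨l, hl, h⟩ := h
    refine ⟨l, hl, intro fun W F v hs x => ?_⟩
    exact (F.sat_box v x _).2 fun y _ => valid h W F v hs y
  | repl _ _ h h' =>
    obtain ⟨l, hl, h⟩ := h
    obtain ⟨l', hl', h'⟩ := h'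
    refine ⟨l ++ l', by simpa [or_imp, forall_and] using ⟨hl, hl'⟩, intro fun W F v hs x => ?_⟩
    have h := valid h W F v (fun y γ hγ => hs y γ (List.mem_append_left _ hγ))
    have h' := valid h' W F v (fun y γ hγ => hs y γ (List.mem_append_right _ hγ))
    simp only [Frame.sat_iff, Frame.sat_strict] at h h' ⊢
    simp only [h, h']

theorem MS2ICuFrom_iff (Γ : Set (Fml V)) (φ : Fml V) : MS2ICuFrom Γ φ ↔ MS2IC Γ φ := by
  simp only [MS2ICuFrom, MS2ICu_iff]
  constructor
  · rintro ⟨l, hl, h⟩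
    exact .MP (.R (.conj hl)) (h.mono (Set.empty_subset Γ))
  · exact MS2IC.deduction

end Rules

end MS2

theorem mainTheorem3 (V : Type*) :
    (∀ φ : MS2.Fml V, MS2.MS2ICu φ ↔ MS2.MS2IC ∅ φ) ∧
    (∀ (Γ : Set (MS2.Fml V)) (φ : MS2.Fml V), MS2.MS2ICuFrom Γ φ ↔ MS2.MS2IC Γ φ) ∧
    MS2.Admissible (MS2.Rho6 (V := V)) ∧
    MS2.Admissible (MS2.Rho7 (V := V)) ∧
    MS2.Admissible (MS2.UC (V := V)) :=
  ⟨MS2.MS2ICu_iff, MS2.MS2ICuFrom_iff, MS2.admissible_rho6, MS2.admissible_rho7, MS2.admissible_uc⟩
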